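/- **Strong maximum principle.** Let $n\ge 1$, let $U\subset\mathbb R^n$ be a non-empty, open, bounded and connected set, let $T>0$, and write $U_s=U\times(0,s]$ for $0<s\le T$. Let $J\subset\mathbb R$ be an interval with non-empty interior and let $P\in C^1(J,\mathbb R)$ with $P'\ge 0$ on $J$. Let $A:U_T\to\mathbb R^{n\times n}$ have symmetric values, and let $K:U_T\to\mathbb R^{n\times n}$ and $B:U_T\to\mathbb R^n$ be given functions. Assume that there is a constant $c_0>0$ such that $$\xi^{\rm T}A(x,t)\xi\ge c_0|\xi|^2\quad\text{for all }(x,t)\in U_T,\ \xi\in\mathbb R^n,$$ and that $A$ and $B$ are bounded on $U_T$. Let $u$ be bounded on $U_T$, with $u(U_T)\subset J$ and $u\in C^{2,1}_{x,t}(U_T)$, i.e. $u$ is continuous on $U_T$ and $\partial u/\partial t$, $\partial u/\partial x_i$, $\partial^2u/\partial x_i\partial x_j$ exist and are continuous on $U_T$ (with $\partial u/\partial t$ one-sided at $t=T$). Define $$Lu=\frac{\partial u}{\partial t}-\operatorname{Tr}\big(A(x,t)^{\rm T}D^2u\big)+u\,B(x,t)\cdot\nabla u+P'(u)\,(K(x,t)\nabla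 u)\cdot\nabla u ,$$ where $P'$ is one-sided at an end point belonging to $J$. (i) Assume that there is a constant $c_1\ge0$ with $\xi^{\rm T}K(x,t)\xi\ge -c_1|\xi|^2$ for all $(x,t)\in U_T$ and $\xi\in\mathbb R^n$, and that $Lu\le 0$ on $U_T$. Let $M=\sup_{U_T}u$. If $u(x_0,t_0)=M$ for some $(x_0,t_0)\in U_T$, then $u(x,t)=M$ for all $(x,t)\in U_{t_0}=U\times(0,t_0]$. (ii) Assume that there is a constant $c_2\ge0$ with $\xi^{\rm T}K(x,t)\xi\le c_2|\xi|^2$ for all $(x,t)\in U_T$ and $\xi\in\mathbb R^n$, and that $Lu\ge 0$ on $U_T$. Let $m=\inf_{U_T}u$. If $u(x_0,t_0)=m$ for some $(x_0,t_0)\in U_T$, then $u(x,t)=m$ for all $(x,t)\in U_{t_0}=U\times(0,t_0]$. -/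

import Mathlib

open Set

namespace FluidPDE

noncomputable section

/-- The partial derivative `∂f/∂xᵢ` at `x` of a real function on `ℝⁿ`. -/
def pderiv {n : ℕ} (i : Fin n) (f : EuclideanSpace ℝ (Fin n) → ℝ)
    (x : EuclideanSpace ℝ (Fin n)) : ℝ :=
  lineDeriv ℝ f x (EuclideanSpace.single i 1)

/-- The partial derivative `∂f/∂xᵢ` exists at `x`. -/
def HasPderiv {n : ℕ} (i : Fin n) (f : EuclideanSpace ℝ (Fin n) → ℝ)
    (x : EuclideanSpace ℝ (Fin n)) : Prop :=
  LineDifferentiableAt ℝ f x (EuclideanSpace.single i 1)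

/-- The spatial gradient `∇f = (∂f/∂x₁, …, ∂f/∂xₙ)`. -/
def grad {n : ℕ} (f : EuclideanSpace ℝ (Fin n) → ℝ) (x : EuclideanSpace ℝ (Fin n)) :
    EuclideanSpace ℝ (Fin n) :=
  WithLp.toLp 2 fun i => pderiv i f x

/-- The spatial Hessian `D²f = (∂²f/∂xᵢ∂xⱼ)`. -/
def hess {n : ℕ} (f : EuclideanSpace ℝ (Fin n) → ℝ) (x : EuclideanSpace ℝ (Fin n)) :
    Matrix (Fin n) (Fin n) ℝ :=
  Matrix.of fun i j => pderiv i (pderiv j f) x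

/-- The class `C^{2,1}_{x,t}(U × I)` for an open `U ⊆ ℝⁿ` and an interval `I`: `u` is continuous
on `U × I`, and `∂u/∂t`, `∂u/∂xᵢ`, `∂²u/∂xᵢ∂xⱼ` exist and are continuous on `U × I`. The time
derivative is taken within `I`, so it is one-sided at an end point that belongs to `I`. -/
structure IsC21 {n : ℕ} (U : Set (EuclideanSpace ℝ (Fin n))) (I : Set ℝ)
    (u : EuclideanSpace ℝ (Fin n) → ℝ → ℝ) : Prop where
  cont : ContinuousOn (fun p : EuclideanSpace ℝ (Fin n) × ℝ => u p.1 p.2) (U ×ˢ I)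
  diff_t : ∀ x ∈ U, ∀ t ∈ I, DifferentiableWithinAt ℝ (u x) I t
  cont_t : ContinuousOn
    (fun p : EuclideanSpace ℝ (Fin n) × ℝ => derivWithin (u p.1) I p.2) (U ×ˢ I)
  diff_x : ∀ i, ∀ x ∈ U, ∀ t ∈ I, HasPderiv i (fun y => u y t) x
  cont_x : ∀ i, ContinuousOn
    (fun p : EuclideanSpace ℝ (Fin n) × ℝ => pderiv i (fun y => u y p.2) p.1) (U ×ˢ I)
  diff_xx : ∀ i j, ∀ x ∈ U, ∀ t ∈ I, HasPderiv i (pderiv j fun y => u y t) x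
  cont_xx : ∀ i j, ContinuousOn
    (fun p : EuclideanSpace ℝ (Fin n) × ℝ => pderiv i (pderiv j fun y => u y p.2) p.1)
    (U ×ˢ I)

/-- The quadratic form `ξᵀ M ξ`. -/
def quad {n : ℕ} (M : Matrix (Fin n) (Fin n) ℝ) (ξ : EuclideanSpace ℝ (Fin n)) : ℝ :=
  ∑ i, ∑ j, ξ i * M i j * ξ j

/-- The nonlinear operator
`Lu = ∂u/∂t - ⟨A, D²u⟩ + u B · ∇u + P'(u) (K ∇u) · ∇u` at `(x, t)`,
where `⟨A, H⟩ = Tr(Aᵀ H)`. The functions `u` and `P` live on `U × I` and on the interval `J`,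
and the derivatives in `t` and of `P` are taken within `I` and `J`. -/
def opL {n : ℕ} (A K : EuclideanSpace ℝ (Fin n) → ℝ → Matrix (Fin n) (Fin n) ℝ)
    (B : EuclideanSpace ℝ (Fin n) → ℝ → EuclideanSpace ℝ (Fin n))
    (J : Set ℝ) (P : ℝ → ℝ) (I : Set ℝ) (u : EuclideanSpace ℝ (Fin n) → ℝ → ℝ)
    (x : EuclideanSpace ℝ (Fin n)) (t : ℝ) : ℝ :=
  derivWithin (u x) I t
    - ((A x t).transpose * hess (fun y => u y t) x).trace
    + u x t * inner ℝ (B x t) (grad (fun y => u y t) x)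
    + derivWithin P J (u x t) * quad (K x t) (grad (fun y => u y t) x)

end

end FluidPDE

namespace FluidPDE

open Filter Topology
open scoped MatrixOrder

variable {n : ℕ}

/-! ### Matrices and quadratic forms -/

/-! On a compact set u B and P'(u)|∇u| are bounded. With P' ≥ 0 and the one-sided bound on K, Lu ≥ 0
therefore gives 0 ≤ ∂u/∂t - Tr(AᵀD²u) + C|∇u| there, with C depending on the compact set
(`exists_firstOrder_le`). If Lu ≤ 0, then -u satisfies an inequality of this form, so both parts
follow from one minimum principle, `eq_of_isMin_of_supersolution`.

Its core is `pos_of_segment_subset`: strict positivity of u - m travels forward in time along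
segments. Slide a ball of radius r along the segment, with centre c(t), and compare u - m with the
bump k(t)(r² - |x - c(t)|²)², where k decays exponentially. The bump vanishes on the lateral
boundary and starts below u - m. Ellipticity near the lateral boundary and fast decay inside make it
a strict subsolution, so u - m stays above it. Chaining segments through the connected set U, a
value above m anywhere would force u > m at x₀ at every later time, contradicting u(x₀, t₀) = m. -/

theorem quad_eq_dotProduct (M : Matrix (Fin n) (Fin n) ℝ) (ξ : EuclideanSpace ℝ (Fin n)) :
    quad M ξ = dotProduct (ξ : Fin n → ℝ) (M.mulVec ξ) := by
  simp only [quad, dotProduct, Matrix.mulVec, Finset.mul_sum, mul_assoc]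

/-- The trace pairing of two matrices with nonnegative quadratic forms is nonnegative, if one of
them is symmetric. -/
theorem trace_transpose_mul_nonneg {A H : Matrix (Fin n) (Fin n) ℝ} (hA : A.IsSymm)
    (hA0 : ∀ ξ, 0 ≤ quad A ξ) (hH : ∀ ξ, 0 ≤ quad H ξ) : 0 ≤ (A.transpose * H).trace := by
  have hpsd : A.PosSemidef := by
    refine .of_dotProduct_mulVec_nonneg
      ((Matrix.conjTranspose_eq_transpose_of_trivial A).trans hA) fun x => ?_
    simpa [quad_eq_dotProduct] using hA0 (WithLp.toLp 2 x)
  -- With A = SᵀS the trace becomes Tr(S H Sᵀ), the sum of the quadratic form of H over the rows of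
  -- S.
  obtain ⟨S, rfl⟩ := (CStarAlgebra.nonneg_iff_eq_star_mul_self (a := A)).1 hpsd.nonneg
  rw [hA, Matrix.star_eq_conjTranspose, Matrix.conjTranspose_eq_transpose_of_trivial,
    Matrix.mul_assoc, Matrix.trace_mul_comm, Matrix.trace]
  refine Finset.sum_nonneg fun k _ => ?_
  have h := hH (WithLp.toLp 2 (S k))
  rw [quad_eq_dotProduct] at h
  have e : (S * H * S.transpose).diag k = dotProduct (S k) (H.mulVec (S k)) := by
    rw [Matrix.mul_assoc]
    simp [Matrix.mul_apply, dotProduct, Matrix.mulVec]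
  rwa [e]

/-- The quadratic form of `a z zᵀ - b I`. -/
theorem quad_rankOne_sub_scalar (a b : ℝ) (z ξ : EuclideanSpace ℝ (Fin n)) :
    quad (Matrix.of fun i j => a * (z i * z j) - if i = j then b else 0) ξ =
      a * inner ℝ z ξ ^ 2 - b * ‖ξ‖ ^ 2 := by
  have h1 : inner ℝ z ξ = ∑ i, z i * ξ i := by
    simp [PiLp.inner_apply, mul_comm]
  have h2 : ‖ξ‖ ^ 2 = ∑ i, ξ i * ξ i := by
    rw [EuclideanSpace.real_norm_sq_eq]
    exact Finset.sum_congr rfl fun i _ => pow_two _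
  simp only [quad, Matrix.of_apply, mul_sub, sub_mul, Finset.sum_sub_distrib]
  congr 1
  · rw [h1, pow_two, Finset.sum_mul_sum, Finset.mul_sum]
    refine Finset.sum_congr rfl fun i _ => ?_
    rw [Finset.mul_sum]
    exact Finset.sum_congr rfl fun j _ => by ring
  · rw [h2, Finset.mul_sum]
    refine Finset.sum_congr rfl fun i _ => ?_
    simp
    ring

/-- The trace pairing of `A` with `a z zᵀ - b I`. -/
theorem trace_transpose_mul_rankOne_sub_scalar (A : Matrix (Fin n) (Fin n) ℝ) (a b : ℝ)
    (z : EuclideanSpace ℝ (Fin n)) :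
    (A.transpose * Matrix.of fun i j => a * (z i * z j) - if i = j then b else 0).trace =
      a * quad A z - b * A.trace := by
  simp only [Matrix.trace, Matrix.diag_apply, Matrix.mul_apply, Matrix.transpose_apply,
    Matrix.of_apply, mul_sub, Finset.sum_sub_distrib, quad]
  congr 1
  · rw [Finset.sum_comm, Finset.mul_sum]
    refine Finset.sum_congr rfl fun i _ => ?_
    rw [Finset.mul_sum]
    exact Finset.sum_congr rfl fun j _ => by ring
  · simp [Finset.mul_sum, mul_comm]

/-! ### Directional derivatives from partial derivatives -/

/-- If the partial derivatives exist near `x` and are continuous at `x`, the directional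
derivatives are linear combinations of them. -/
theorem hasLineDerivAt_sum {f : EuclideanSpace ℝ (Fin n) → ℝ} {x : EuclideanSpace ℝ (Fin n)}
    (hd : ∀ i, ∀ᶠ y in 𝓝 x, HasPderiv i f y) (hc : ∀ i, ContinuousAt (pderiv i f) x)
    (ξ : Fin n → ℝ) (s : Finset (Fin n)) :
    HasLineDerivAt ℝ f (∑ i ∈ s, ξ i * pderiv i f x) x
      (∑ i ∈ s, ξ i • EuclideanSpace.single i (1 : ℝ)) := by
  induction s using Finset.induction_on with
  | empty => simpa using hasLineDerivAt_zero (𝕜 := ℝ) (f := f) (x := x)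
  | insert i s hi ih =>
    rw [Finset.sum_insert hi, Finset.sum_insert hi]
    set v := ∑ i ∈ s, ξ i • EuclideanSpace.single i (1 : ℝ) with hv
    set e := EuclideanSpace.single i (1 : ℝ) with he
    set g := pderiv i f x with hg
    unfold HasLineDerivAt at ih ⊢
    rw [hasDerivAt_iff_isLittleO] at ih ⊢
    -- One more coordinate direction is added from the already displaced point x + t v. The mean
    -- value inequality bounds the error, since ∂f/∂xᵢ stays close to its value g at x on the whole
    -- small segment.
    have key : (fun t : ℝ => f (x + t • v + (t * ξ i) • e) - f (x + t • v) - t * ξ i * g)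
        =o[𝓝 0] fun t : ℝ => t := by
      rw [Asymptotics.isLittleO_iff]
      intro c hcpos
      set c' := c / (|ξ i| + 1) with hc'
      have hc'pos : 0 < c' := by positivity
      have hnear : ∀ᶠ y in 𝓝 x, HasPderiv i f y ∧ |pderiv i f y - g| < c' :=
        (hd i).and ((hc i).eventually (Metric.ball_mem_nhds _ hc'pos))
      obtain ⟨δ, hδ, hball⟩ := Metric.eventually_nhds_iff.1 hnear
      have hsmall : ∀ᶠ t : ℝ in 𝓝 0, |t| * (‖v‖ + |ξ i| * ‖e‖) < δ := by
        have : Tendsto (fun t : ℝ => |t| * (‖v‖ + |ξ i| * ‖e‖)) (𝓝 0) (𝓝 0) := by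
          have : Continuous (fun t : ℝ => |t| * (‖v‖ + |ξ i| * ‖e‖)) := by fun_prop
          simpa using this.tendsto 0
        exact this.eventually (gt_mem_nhds hδ)
      filter_upwards [hsmall] with t ht
      set R := |t * ξ i| with hR
      have hder : ∀ r ∈ Icc (-R) R,
          HasDerivWithinAt (fun r : ℝ => f (x + t • v + r • e) - r * g)
            (pderiv i f (x + t • v + r • e) - g) (Icc (-R) R) r ∧
          ‖pderiv i f (x + t • v + r • e) - g‖ ≤ c' := by
        intro r hr
        have hr' : |r| ≤ |t| * |ξ i| := by rw [← abs_mul]; exact abs_le.2 hr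
        have hdist : dist (x + t • v + r • e) x < δ := by
          rw [dist_eq_norm]
          calc ‖x + t • v + r • e - x‖ = ‖t • v + r • e‖ := by congr 1; abel
            _ ≤ ‖t • v‖ + ‖r • e‖ := norm_add_le _ _
            _ = |t| * ‖v‖ + |r| * ‖e‖ := by simp [norm_smul]
            _ ≤ |t| * ‖v‖ + |t| * |ξ i| * ‖e‖ := by gcongr
            _ < δ := by linarith
        obtain ⟨h1, h2⟩ := hball hdist
        refine ⟨?_, h2.le⟩
        have h3 := h1.hasLineDerivAt
        unfold HasLineDerivAt at h3
        have h4 : HasDerivAt (fun r' : ℝ => f (x + t • v + r • e + (r' - r) • e))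
            (pderiv i f (x + t • v + r • e)) r := by
          have h5 := HasDerivAt.comp_sub_const (f := fun s : ℝ => f (x + t • v + r • e + s • e))
            (f' := pderiv i f (x + t • v + r • e)) r r (by rw [sub_self]; exact h3)
          exact h5
        have h6 : (fun r' : ℝ => f (x + t • v + r • e + (r' - r) • e)) =
            fun r' : ℝ => f (x + t • v + r' • e) := by
          funext r'
          congr 1
          rw [add_assoc _ (r • e), ← add_smul]
          simp
        rw [h6] at h4
        have h7 := h4.sub ((hasDerivAt_id r).mul_const g)
        simp only [one_mul] at h7
        exact h7.hasDerivWithinAt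
      have hmv := (convex_Icc (-R) R).norm_image_sub_le_of_norm_hasDerivWithin_le
        (fun r hr => (hder r hr).1) (fun r hr => (hder r hr).2)
        (x := 0) (y := t * ξ i) (by rw [hR]; exact abs_le.1 (by rw [abs_zero]; positivity))
        (abs_le.1 le_rfl)
      simp only [zero_smul, add_zero, zero_mul, sub_zero] at hmv
      have hle : c' * ‖t * ξ i‖ ≤ c * ‖t‖ := by
        rw [norm_mul, hc', div_mul_eq_mul_div, div_le_iff₀ (by positivity)]
        have : 0 ≤ c * ‖t‖ := by positivity
        simp only [Real.norm_eq_abs] at this ⊢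
        nlinarith
      refine le_trans (le_of_eq ?_) (hmv.trans hle)
      congr 1
      ring
    have hsum := key.add (by simpa using ih)
    refine (hsum.congr_left fun t => ?_).congr_right fun t => (sub_zero t).symm
    simp only [zero_smul, add_zero, sub_zero, smul_eq_mul]
    rw [smul_add, smul_smul, add_comm ((t * ξ i) • e), ← add_assoc]
    ring

theorem sum_smul_single (ξ : EuclideanSpace ℝ (Fin n)) :
    ∑ i, ξ i • EuclideanSpace.single i (1 : ℝ) = ξ := by
  ext j
  simp [Finset.sum_apply, Pi.single_apply]

/-- On an open set, `f` with continuous partial derivatives can be differentiated along lines. -/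
theorem hasDerivAt_comp_line {f : EuclideanSpace ℝ (Fin n) → ℝ} {U : Set (EuclideanSpace ℝ (Fin n))}
    (hU : IsOpen U) (hd : ∀ i, ∀ y ∈ U, HasPderiv i f y) (hc : ∀ i, ContinuousOn (pderiv i f) U)
    (x ξ : EuclideanSpace ℝ (Fin n)) (s : ℝ) (hs : x + s • ξ ∈ U) :
    HasDerivAt (fun s : ℝ => f (x + s • ξ)) (∑ i, ξ i * pderiv i f (x + s • ξ)) s := by
  have hnhds := hU.mem_nhds hs
  have h := hasLineDerivAt_sum (x := x + s • ξ)
    (fun i => Filter.eventually_of_mem hnhds (hd i)) (fun i => (hc i).continuousAt hnhds) ξ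
    Finset.univ
  rw [sum_smul_single] at h
  unfold HasLineDerivAt at h
  have h5 := HasDerivAt.comp_sub_const (f := fun r : ℝ => f (x + s • ξ + r • ξ))
    (f' := ∑ i, ξ i * pderiv i f (x + s • ξ)) s s (by rw [sub_self]; exact h)
  have h6 : (fun r : ℝ => f (x + s • ξ + (r - s) • ξ)) = fun r : ℝ => f (x + r • ξ) := by
    funext r
    congr 1
    rw [add_assoc, ← add_smul]
    simp
  rwa [h6] at h5

/-! ### Necessary conditions at a minimum -/

/-- The second-order necessary condition at a local minimum on the line. -/
theorem second_deriv_nonneg_of_isLocalMin {h h' : ℝ → ℝ} {a c : ℝ} (hmin : IsLocalMin h a)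
    (h1 : ∀ᶠ s in 𝓝 a, HasDerivAt h (h' s) s) (h2 : HasDerivAt h' c a) : 0 ≤ c := by
  -- If c < 0, the second derivative test makes a a local maximum as well, so h is locally constant
  -- and c = 0.
  by_contra! hc
  have e1 : deriv h =ᶠ[𝓝 a] h' := h1.mono fun s hs => hs.deriv
  have e2 : deriv (deriv h) a = c := by rw [e1.deriv_eq, h2.deriv]
  have hmax : IsLocalMax h a := isLocalMax_of_deriv_deriv_neg (by rwa [e2]) hmin.deriv_eq_zero
    h1.self_of_nhds.continuousAt
  have hconst : h =ᶠ[𝓝 a] fun _ => h a := by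
    filter_upwards [hmin, hmax] with s hs hs'
    exact le_antisymm hs' hs
  have e3 : deriv (deriv h) a = 0 := by
    rw [hconst.deriv.deriv_eq]
    simp
  linarith

/-- At a minimum over an interval to the left, the left derivative is nonpositive. -/
theorem hasDerivWithinAt_nonpos_of_min {g : ℝ → ℝ} {g' a b : ℝ} (hab : a < b)
    (hg : HasDerivWithinAt g g' (Icc a b) b) (hmin : ∀ t ∈ Icc a b, g b ≤ g t) : g' ≤ 0 := by
  have h := IsLocalMinOn.hasFDerivWithinAt_nonneg (y := a - b)
    (IsMinOn.localize (s := Icc a b) (f := g) (a := b) fun t ht => hmin t ht)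
    hg.hasFDerivWithinAt
    (sub_mem_posTangentConeAt_of_segment_subset (by rw [segment_symm, segment_eq_Icc hab.le]))
  simp at h
  nlinarith

/-- First and second order conditions at a point where `f` minus the bump
`k (r² - |z + ·|²)²` has a local minimum along every line. -/
theorem grad_eq_and_le_quad_hess_of_isLocalMin {f : EuclideanSpace ℝ (Fin n) → ℝ}
    {U : Set (EuclideanSpace ℝ (Fin n))} (hU : IsOpen U)
    (hd : ∀ i, ∀ y ∈ U, HasPderiv i f y) (hc : ∀ i, ContinuousOn (pderiv i f) U)
    (hdd : ∀ i j, ∀ y ∈ U, HasPderiv i (pderiv j f) y)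
    (hcc : ∀ i j, ContinuousOn (pderiv i (pderiv j f)) U)
    {x z : EuclideanSpace ℝ (Fin n)} (hx : x ∈ U) (k r : ℝ)
    (hmin : ∀ ξ : EuclideanSpace ℝ (Fin n),
      IsLocalMin (fun s : ℝ => f (x + s • ξ) - k * (r ^ 2 - ‖z + s • ξ‖ ^ 2) ^ 2) 0) :
    grad f x = (-(4 * k * (r ^ 2 - ‖z‖ ^ 2))) • z ∧
    ∀ ξ : EuclideanSpace ℝ (Fin n),
      8 * k * inner ℝ z ξ ^ 2 - 4 * k * (r ^ 2 - ‖z‖ ^ 2) * ‖ξ‖ ^ 2 ≤ quad (hess f x) ξ := by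
  have hev : ∀ ξ : EuclideanSpace ℝ (Fin n), ∀ᶠ s : ℝ in 𝓝 0, x + s • ξ ∈ U := fun ξ => by
    have hcont : Continuous fun s : ℝ => x + s • ξ := by fun_prop
    exact hcont.continuousAt.eventually_mem (hU.mem_nhds (by simpa using hx))
  -- Along a line the bump is a polynomial in s, so its derivatives are explicit.
  have hbump : ∀ (ξ : EuclideanSpace ℝ (Fin n)) (s : ℝ), k * (r ^ 2 - ‖z + s • ξ‖ ^ 2) ^ 2 =
      k * (r ^ 2 - ‖z‖ ^ 2 - 2 * inner ℝ z ξ * s - ‖ξ‖ ^ 2 * s ^ 2) ^ 2 := fun ξ s => by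
    rw [norm_add_sq_real, inner_smul_right, norm_smul, mul_pow, Real.norm_eq_abs, sq_abs]
    ring
  have h1 : ∀ (ξ : EuclideanSpace ℝ (Fin n)) (s : ℝ), x + s • ξ ∈ U →
      HasDerivAt (fun s : ℝ => f (x + s • ξ) - k * (r ^ 2 - ‖z + s • ξ‖ ^ 2) ^ 2)
        ((∑ i, ξ i * pderiv i f (x + s • ξ)) +
          4 * k * (r ^ 2 - ‖z‖ ^ 2 - 2 * inner ℝ z ξ * s - ‖ξ‖ ^ 2 * s ^ 2) *
            (inner ℝ z ξ + ‖ξ‖ ^ 2 * s)) s := fun ξ s hs => by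
    have hf := hasDerivAt_comp_line hU hd hc x ξ s hs
    simp only [hbump]
    have hq : HasDerivAt
        (fun s : ℝ => r ^ 2 - ‖z‖ ^ 2 - 2 * inner ℝ z ξ * s - ‖ξ‖ ^ 2 * s ^ 2)
        (-(2 * inner ℝ z ξ) - ‖ξ‖ ^ 2 * (2 * s)) s := by
      have := (((hasDerivAt_id s).const_mul (2 * inner ℝ z ξ)).const_sub
        (r ^ 2 - ‖z‖ ^ 2)).sub ((hasDerivAt_pow 2 s).const_mul (‖ξ‖ ^ 2))
      refine this.congr_deriv ?_
      simp
    refine (hf.sub ((hq.pow 2).const_mul k)).congr_deriv ?_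
    simp
    ring
  constructor
  · ext i
    have h0 := (hmin (EuclideanSpace.single i 1)).hasDerivAt_eq_zero
      (h1 _ 0 (by simpa using hx))
    simp [EuclideanSpace.inner_single_right] at h0
    simp only [grad, PiLp.smul_apply, smul_eq_mul]
    linarith
  · intro ξ
    have hsum : HasDerivAt (fun s : ℝ => ∑ j, ξ j * pderiv j f (x + s • ξ))
        (∑ j, ξ j * ∑ i, ξ i * pderiv i (pderiv j f) (x + (0 : ℝ) • ξ)) 0 := by
      refine HasDerivAt.fun_sum fun j _ => HasDerivAt.const_mul (ξ j) ?_
      exact hasDerivAt_comp_line hU (fun i => hdd i j) (fun i => hcc i j) x ξ 0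
        (by simpa using hx)
    have hq : HasDerivAt (fun s : ℝ =>
        4 * k * (r ^ 2 - ‖z‖ ^ 2 - 2 * inner ℝ z ξ * s - ‖ξ‖ ^ 2 * s ^ 2) *
            (inner ℝ z ξ + ‖ξ‖ ^ 2 * s))
        (-(8 * k * inner ℝ z ξ ^ 2) + 4 * k * (r ^ 2 - ‖z‖ ^ 2) * ‖ξ‖ ^ 2) 0 := by
      have ha := (((hasDerivAt_id (0 : ℝ)).const_mul (2 * inner ℝ z ξ)).const_sub
        (r ^ 2 - ‖z‖ ^ 2)).sub ((hasDerivAt_pow 2 (0 : ℝ)).const_mul (‖ξ‖ ^ 2))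
      have hb := ((hasDerivAt_id (0 : ℝ)).const_mul (‖ξ‖ ^ 2)).const_add (inner ℝ z ξ)
      refine ((ha.const_mul (4 * k)).mul hb).congr_deriv ?_
      simp only [Pi.sub_apply, id]
      ring
    have h2 := second_deriv_nonneg_of_isLocalMin (hmin ξ) ((hev ξ).mono fun s hs => h1 ξ s hs)
      (hsum.add hq)
    have hquad : quad (hess f x) ξ =
        ∑ j, ξ j * ∑ i, ξ i * pderiv i (pderiv j f) (x + (0 : ℝ) • ξ) := by
      simp only [quad, hess, Matrix.of_apply, zero_smul, add_zero, Finset.mul_sum]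
      rw [Finset.sum_comm]
      exact Finset.sum_congr rfl fun j _ => Finset.sum_congr rfl fun i _ => by ring
    linarith

/-- If the quadratic form of `H` dominates that of `a z zᵀ - b I`, so does its trace pairing with a
positive semidefinite `A`. -/
theorem le_trace_transpose_mul_of_le_quad {A H : Matrix (Fin n) (Fin n) ℝ} (hA : A.IsSymm)
    (hA0 : ∀ ξ, 0 ≤ quad A ξ) (a b : ℝ) (z : EuclideanSpace ℝ (Fin n))
    (h : ∀ ξ : EuclideanSpace ℝ (Fin n), a * inner ℝ z ξ ^ 2 - b * ‖ξ‖ ^ 2 ≤ quad H ξ) :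
    a * quad A z - b * A.trace ≤ (A.transpose * H).trace := by
  set H' : Matrix (Fin n) (Fin n) ℝ :=
    Matrix.of fun i j => a * (z i * z j) - if i = j then b else 0
  have hsub : ∀ ξ, 0 ≤ quad (H - H') ξ := fun ξ => by
    have e : quad (H - H') ξ = quad H ξ - quad H' ξ := by
      simp only [quad, Matrix.sub_apply, mul_sub, sub_mul, Finset.sum_sub_distrib]
    rw [e, quad_rankOne_sub_scalar]
    linarith [h ξ]
  have := trace_transpose_mul_nonneg hA hA0 hsub
  rw [Matrix.mul_sub, Matrix.trace_sub, trace_transpose_mul_rankOne_sub_scalar] at this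
  linarith

/-- `α ρ² - D ρ + β` has no real zeros for `α = D² / (2 β)` and `β > 0`. -/
theorem quadratic_pos {β : ℝ} (hβ : 0 < β) (D ρ : ℝ) : 0 < D ^ 2 / (2 * β) * ρ ^ 2 - D * ρ + β := by
  have e : D ^ 2 / (2 * β) * ρ ^ 2 - D * ρ + β = ((D * ρ - β) ^ 2 + β ^ 2) / (2 * β) := by
    field_simp
    ring
  rw [e]
  positivity

/-- A nonnegative supersolution that is positive at `(x₁, t₁)` is positive at `(x₂, t₂)` for every
later time `t₂` and every `x₂` joined to `x₁` by a segment in `U`. -/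
theorem pos_of_segment_subset {U : Set (EuclideanSpace ℝ (Fin n))} (hU : IsOpen U) {T : ℝ}
    {A : EuclideanSpace ℝ (Fin n) → ℝ → Matrix (Fin n) (Fin n) ℝ}
    (hAsymm : ∀ x ∈ U, ∀ t ∈ Ioc 0 T, (A x t).IsSymm) {c₀ : ℝ} (hc₀ : 0 < c₀)
    (hAell : ∀ x ∈ U, ∀ t ∈ Ioc 0 T, ∀ ξ : EuclideanSpace ℝ (Fin n),
      c₀ * ‖ξ‖ ^ 2 ≤ quad (A x t) ξ)
    {a : ℝ} (hAtr : ∀ x ∈ U, ∀ t ∈ Ioc 0 T, (A x t).trace ≤ a)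
    {u : EuclideanSpace ℝ (Fin n) → ℝ → ℝ} (hu : IsC21 U (Ioc 0 T) u)
    (hsuper : ∀ S ⊆ U ×ˢ Ioc 0 T, IsCompact S → ∃ C : ℝ, ∀ p ∈ S,
      0 ≤ derivWithin (u p.1) (Ioc 0 T) p.2
        - ((A p.1 p.2).transpose * hess (fun y => u y p.2) p.1).trace
        + C * ‖grad (fun y => u y p.2) p.1‖)
    {m : ℝ} (hm : ∀ x ∈ U, ∀ t ∈ Ioc 0 T, m ≤ u x t)
    {x₁ x₂ : EuclideanSpace ℝ (Fin n)} (hseg : segment ℝ x₁ x₂ ⊆ U) {t₁ t₂ : ℝ} (ht₁ : 0 < t₁)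
    (ht : t₁ < t₂) (ht₂ : t₂ ≤ T) (hpos : m < u x₁ t₁) : m < u x₂ t₂ := by
  have hsegc : IsCompact (segment ℝ x₁ x₂) := by
    rw [segment_eq_image']
    exact isCompact_Icc.image (by fun_prop)
  obtain ⟨R, hR, hRU⟩ := hsegc.exists_cthickening_subset_open hU hseg
  have hx₁U : x₁ ∈ U := hseg (left_mem_segment ℝ x₁ x₂)
  have ht₁I : t₁ ∈ Ioc 0 T := ⟨ht₁, (ht.trans_le ht₂).le⟩
  have hslice : ContinuousOn (fun x => u x t₁) U :=
    hu.cont.comp (f := fun x => (x, t₁)) (by fun_prop) fun x hx => ⟨hx, ht₁I⟩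
  -- Half the gap, so that u > m + μ still holds at time t₁ on a small ball around x₁.
  set μ := (u x₁ t₁ - m) / 2 with hμ
  have hμ0 : 0 < μ := by rw [hμ]; linarith
  have hnear : ∀ᶠ x in 𝓝 x₁, m + μ < u x t₁ :=
    (hslice.continuousAt (hU.mem_nhds hx₁U)).eventually (lt_mem_nhds (by rw [hμ]; linarith))
  obtain ⟨δ, hδ, hδball⟩ := Metric.eventually_nhds_iff.1 hnear
  obtain ⟨r, hr0, hrR, hrδ⟩ : ∃ r, 0 < r ∧ r ≤ R ∧ r < δ :=
    ⟨min R (δ / 2), by positivity, min_le_left _ _, (min_le_right _ _).trans_lt (by linarith)⟩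
  -- the slanted cylinder
  set ξ : EuclideanSpace ℝ (Fin n) := (t₂ - t₁)⁻¹ • (x₂ - x₁) with hξ
  set c : ℝ → EuclideanSpace ℝ (Fin n) := fun t => x₁ + (t - t₁) • ξ with hcdef
  have hc_cont : Continuous c := by fun_prop
  have hc₂ : c t₂ = x₂ := by
    simp only [hcdef, hξ, smul_smul]
    rw [mul_inv_cancel₀ (by linarith)]
    simp
  have hc₁ : c t₁ = x₁ := by simp [hcdef]
  have hcU : ∀ z : EuclideanSpace ℝ (Fin n), ‖z‖ ≤ r → ∀ t ∈ Icc t₁ t₂, c t + z ∈ U := by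
    intro z hz t htt
    refine hRU (Metric.mem_cthickening_of_dist_le _ (c t) _ _ ?_ (by simpa using hz.trans hrR))
    rw [segment_eq_image']
    refine ⟨(t - t₁) / (t₂ - t₁), ⟨div_nonneg (by linarith [htt.1]) (by linarith),
      (div_le_one (by linarith)).2 (by linarith [htt.2])⟩, ?_⟩
    simp only [hcdef, hξ, smul_smul, div_eq_mul_inv]
  have hI : ∀ t ∈ Icc t₁ t₂, t ∈ Ioc 0 T := fun t h => ⟨ht₁.trans_le h.1, h.2.trans ht₂⟩
  set Q : Set (EuclideanSpace ℝ (Fin n) × ℝ) := Metric.closedBall 0 r ×ˢ Icc t₁ t₂ with hQ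
  have hQc : IsCompact Q := (isCompact_closedBall _ _).prod isCompact_Icc
  -- The minimization takes place on the straight cylinder Q; Φ shears it onto the slanted one in U
  -- × (0, T].
  set Φ : EuclideanSpace ℝ (Fin n) × ℝ → EuclideanSpace ℝ (Fin n) × ℝ :=
    fun p => (c p.2 + p.1, p.2) with hΦ
  have hΦc : Continuous Φ := by fun_prop
  have hΦU : MapsTo Φ Q (U ×ˢ Ioc 0 T) := fun p hp =>
    ⟨hcU _ (by simpa using hp.1) _ hp.2, hI _ hp.2⟩
  obtain ⟨C', hC'⟩ := hsuper (Φ '' Q) hΦU.image_subset (hQc.image hΦc)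
  set C := max C' 0 with hC
  have hC0 : 0 ≤ C := le_max_right _ _
  -- the barrier
  set D := 4 * r * ‖ξ‖ + 4 * a + 4 * C * r + 8 * c₀ with hD
  set α := D ^ 2 / (2 * (8 * c₀ * r ^ 2)) with hα
  have hα0 : 0 ≤ α := by positivity
  -- The factor μ / r⁴ keeps the bump at most μ at time t₁.
  set k : ℝ → ℝ := fun t => μ / r ^ 4 * Real.exp (-α * (t - t₁)) with hk
  have hk0 : ∀ t, 0 < k t := fun t => by positivity
  set F : EuclideanSpace ℝ (Fin n) × ℝ → ℝ := fun p =>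
    u (c p.2 + p.1) p.2 - k p.2 * (r ^ 2 - ‖p.1‖ ^ 2) ^ 2 with hF
  have hFc : ContinuousOn F Q := by
    refine ContinuousOn.sub (hu.cont.comp hΦc.continuousOn hΦU) (Continuous.continuousOn ?_)
    fun_prop
  obtain ⟨⟨z, t⟩, hzt, hminF⟩ := hQc.exists_isMinOn
    ⟨((0 : EuclideanSpace ℝ (Fin n)), t₁), by simp [hQ, hr0.le, ht.le]⟩ hFc
  have hz : ‖z‖ ≤ r := by simpa using hzt.1
  have htt : t ∈ Icc t₁ t₂ := hzt.2
  have hFmin : ∀ z' : EuclideanSpace ℝ (Fin n), ‖z'‖ ≤ r → ∀ t' ∈ Icc t₁ t₂, F (z, t) ≤ F (z', t') :=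
    fun z' hz' t' ht' => hminF (show (z', t') ∈ Q from ⟨by simpa using hz', ht'⟩)
  -- At time t₂ the centre is x₂, where the bump is strictly positive.
  suffices hFm : m ≤ F (z, t) by
    have h1 := hFm.trans (hFmin 0 (by simpa using hr0.le) t₂ ⟨ht.le, le_rfl⟩)
    simp only [hF, add_zero, hc₂] at h1
    have h2 : 0 < k t₂ * (r ^ 2 - ‖(0 : EuclideanSpace ℝ (Fin n))‖ ^ 2) ^ 2 := by
      have := hk0 t₂
      rw [norm_zero, zero_pow two_ne_zero, sub_zero]
      positivity
    linarith
  by_contra! hneg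
  set x := c t + z with hx
  have hxU : x ∈ U := hcU z hz t htt
  have htI := hI t htt
  have hFzt : F (z, t) = u x t - k t * (r ^ 2 - ‖z‖ ^ 2) ^ 2 := rfl
  -- A minimum below m lies neither on the lateral boundary, where the bump vanishes, nor at the
  -- initial time, where u > m + μ. The final time t₂ is not excluded.
  have hzr : ‖z‖ < r := by
    refine lt_of_le_of_ne hz fun h => ?_
    rw [hFzt, h] at hneg
    have := hm x hxU t htI
    simp at hneg
    linarith
  have htt₁ : t₁ < t := by
    refine lt_of_le_of_ne htt.1 fun h => ?_
    have hb : k t * (r ^ 2 - ‖z‖ ^ 2) ^ 2 ≤ μ := by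
      have h1 : (r ^ 2 - ‖z‖ ^ 2) ^ 2 ≤ r ^ 4 := by
        have h2 : r ^ 4 = (r ^ 2) ^ 2 := by ring
        have h3 : ‖z‖ ^ 2 ≤ r ^ 2 := by gcongr
        rw [h2]
        exact pow_le_pow_left₀ (by linarith) (by linarith [sq_nonneg ‖z‖]) 2
      simp only [hk, ← h, sub_self, mul_zero, Real.exp_zero, mul_one]
      rw [div_mul_eq_mul_div, div_le_iff₀ (by positivity)]
      gcongr
    have h2 : m + μ < u x t := by
      rw [← h]
      refine hδball ?_
      rw [hx, ← h, hc₁]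
      simpa using hz.trans_lt hrδ
    linarith
  -- spatial conditions
  have hline : ∀ η : EuclideanSpace ℝ (Fin n),
      IsLocalMin (fun s : ℝ => u (x + s • η) t - k t * (r ^ 2 - ‖z + s • η‖ ^ 2) ^ 2) 0 := by
    intro η
    have hcont : Continuous fun s : ℝ => ‖z + s • η‖ := by fun_prop
    have hev : ∀ᶠ s : ℝ in 𝓝 0, ‖z + s • η‖ < r :=
      hcont.continuousAt.eventually (gt_mem_nhds (by simpa using hzr))
    filter_upwards [hev] with s hs
    have := hFmin (z + s • η) hs.le t htt
    simp only [hF, ← add_assoc] at this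
    simpa using this
  have hsl : ∀ {g : EuclideanSpace ℝ (Fin n) → ℝ → ℝ},
      ContinuousOn (fun p : EuclideanSpace ℝ (Fin n) × ℝ => g p.1 p.2) (U ×ˢ Ioc 0 T) →
      ContinuousOn (fun y => g y t) U := fun hg =>
    hg.comp (f := fun y => (y, t)) (by fun_prop) fun y hy => ⟨hy, htI⟩
  obtain ⟨hgrad, hhess⟩ := grad_eq_and_le_quad_hess_of_isLocalMin (f := fun y => u y t) hU
    (fun i y hy => hu.diff_x i y hy t htI)
    (fun i => hsl (g := fun y t => pderiv i (fun y => u y t) y) (hu.cont_x i))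
    (fun i j y hy => hu.diff_xx i j y hy t htI)
    (fun i j => hsl (g := fun y t => pderiv i (pderiv j fun y => u y t) y) (hu.cont_xx i j))
    hxU (k t) r hline
  have htrace := le_trace_transpose_mul_of_le_quad (hAsymm x hxU t htI)
    (fun η => le_trans (by positivity) (hAell x hxU t htI η)) _ _ z hhess
  -- condition in time
  have htime : derivWithin (u x) (Ioc 0 T) t ≤
      k t * (-α * (r ^ 2 - ‖z‖ ^ 2) ^ 2 + 4 * (r ^ 2 - ‖z‖ ^ 2) * inner ℝ z ξ) := by
    -- Here x is fixed while the centre moves, which produces the drift term in ξ. Only earlier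
    -- times are compared, so t = t₂ is covered.
    have hcont : Continuous fun s : ℝ => ‖x - c s‖ := by fun_prop
    have hev : ∀ᶠ s in 𝓝 t, ‖x - c s‖ < r :=
      hcont.continuousAt.eventually (gt_mem_nhds (by simpa [hx] using hzr))
    obtain ⟨ε, hε, hball⟩ := Metric.eventually_nhds_iff.1 hev
    set l := max t₁ (t - ε / 2) with hl
    have hlt : l < t := max_lt htt₁ (by linarith)
    have hl₁ : t₁ ≤ l := le_max_left _ _
    have hu' : HasDerivWithinAt (u x) (derivWithin (u x) (Ioc 0 T) t) (Icc l t) t :=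
      (hu.diff_t x hxU t htI).hasDerivWithinAt.mono fun s hs =>
        hI s ⟨hl₁.trans hs.1, hs.2.trans htt.2⟩
    have hnorm : ∀ s, r ^ 2 - ‖x - c s‖ ^ 2 =
        r ^ 2 - ‖z‖ ^ 2 + 2 * inner ℝ z ξ * (s - t) - ‖ξ‖ ^ 2 * (s - t) ^ 2 := fun s => by
      have e : x - c s = z + (t - s) • ξ := by
        simp only [hx, hcdef, sub_smul]
        abel
      rw [e, norm_add_sq_real, inner_smul_right, norm_smul, mul_pow, Real.norm_eq_abs, sq_abs]
      ring
    have hρ : HasDerivAt (fun s => r ^ 2 - ‖x - c s‖ ^ 2) (2 * inner ℝ z ξ) t := by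
      simp only [hnorm]
      have hid := (hasDerivAt_id t).sub_const t
      have := ((hid.const_mul (2 * inner ℝ z ξ)).const_add (r ^ 2 - ‖z‖ ^ 2)).sub
        ((hid.pow 2).const_mul (‖ξ‖ ^ 2))
      refine this.congr_deriv ?_
      simp
    have hk' : HasDerivAt k (-α * k t) t := by
      have := ((((hasDerivAt_id t).sub_const t₁).const_mul (-α)).exp).const_mul (μ / r ^ 4)
      refine this.congr_deriv ?_
      simp only [hk, id]
      ring
    have hg := hu'.sub (hk'.mul (hρ.pow 2)).hasDerivWithinAt
    have hle := hasDerivWithinAt_nonpos_of_min hlt hg fun s hs => by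
      have hs' : ‖x - c s‖ < r := by
        refine hball ?_
        rw [Real.dist_eq, abs_lt]
        have := (le_max_right _ _).trans hs.1
        constructor <;> linarith [hs.2]
      have := hFmin (x - c s) hs'.le s ⟨hl₁.trans hs.1, hs.2.trans htt.2⟩
      simpa [hF, hx] using this
    have hxc : x - c t = z := by simp [hx]
    simp only [Pi.pow_apply, hxc] at hle
    norm_num at hle
    linarith
  have hineq := hC' (x, t) ⟨(z, t), hzt, rfl⟩
  simp only [hgrad, norm_smul, norm_neg, Real.norm_eq_abs] at hineq
  have hkt := hk0 t
  set p := r ^ 2 - ‖z‖ ^ 2 with hp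
  have hp0 : 0 < p := by
    have : ‖z‖ ^ 2 < r ^ 2 := by gcongr
    linarith
  rw [abs_of_pos (by positivity)] at hineq
  have b1 : inner ℝ z ξ ≤ r * ‖ξ‖ := (real_inner_le_norm z ξ).trans (by gcongr)
  have b2 := hAell x hxU t htI z
  have b3 := hAtr x hxU t htI
  have b4 : C' * ‖z‖ ≤ C * r :=
    (mul_le_mul_of_nonneg_right (le_max_left _ _) (norm_nonneg z)).trans (by gcongr)
  have hzp : ‖z‖ ^ 2 = r ^ 2 - p := by rw [hp]; ring
  rw [hzp] at b2
  have b1' := mul_le_mul_of_nonneg_left b1 hp0.le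
  have b3' := mul_le_mul_of_nonneg_left b3 hp0.le
  have b4' := mul_le_mul_of_nonneg_left b4 hp0.le
  have hqp := quadratic_pos (β := 8 * c₀ * r ^ 2) (by positivity) D p
  rw [← hα] at hqp
  -- The minimum conditions inserted in the differential inequality; every term carries the factor
  -- k(t) > 0. The remaining bracket is negative by the choice of α.
  have hfin : 0 ≤ k t * (-α * p ^ 2 + 4 * p * inner ℝ z ξ - 8 * quad (A x t) z
      + 4 * p * (A x t).trace + 4 * (p * (C' * ‖z‖))) := by
    linarith
  have hfin' := nonneg_of_mul_nonneg_right hfin hkt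
  have hDp : D * p = 4 * (p * (r * ‖ξ‖)) + 4 * (p * a) + 4 * (p * (C * r)) + 8 * c₀ * p := by
    rw [hD]; ring
  linarith

/-- The strong minimum principle for supersolutions with locally bounded first order terms. -/
theorem eq_of_isMin_of_supersolution {U : Set (EuclideanSpace ℝ (Fin n))} (hU : IsOpen U)
    (hUc : IsPreconnected U) {T : ℝ}
    {A : EuclideanSpace ℝ (Fin n) → ℝ → Matrix (Fin n) (Fin n) ℝ}
    (hAsymm : ∀ x ∈ U, ∀ t ∈ Ioc 0 T, (A x t).IsSymm)
    (hAell : ∃ c₀ : ℝ, 0 < c₀ ∧ ∀ x ∈ U, ∀ t ∈ Ioc 0 T, ∀ ξ : EuclideanSpace ℝ (Fin n),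
      c₀ * ‖ξ‖ ^ 2 ≤ quad (A x t) ξ)
    (hAbdd : ∃ C : ℝ, ∀ x ∈ U, ∀ t ∈ Ioc 0 T, ∀ i j, |A x t i j| ≤ C)
    {u : EuclideanSpace ℝ (Fin n) → ℝ → ℝ} (hu : IsC21 U (Ioc 0 T) u)
    (hsuper : ∀ S ⊆ U ×ˢ Ioc 0 T, IsCompact S → ∃ C : ℝ, ∀ p ∈ S,
      0 ≤ derivWithin (u p.1) (Ioc 0 T) p.2
        - ((A p.1 p.2).transpose * hess (fun y => u y p.2) p.1).trace
        + C * ‖grad (fun y => u y p.2) p.1‖)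
    {m : ℝ} (hm : ∀ x ∈ U, ∀ t ∈ Ioc 0 T, m ≤ u x t)
    {x₀ : EuclideanSpace ℝ (Fin n)} (hx₀ : x₀ ∈ U) {t₀ : ℝ} (ht₀ : t₀ ∈ Ioc 0 T)
    (h₀ : u x₀ t₀ = m) : ∀ x ∈ U, ∀ t ∈ Ioc 0 t₀, u x t = m := by
  obtain ⟨c₀, hc₀, hAell⟩ := hAell
  obtain ⟨C, hC⟩ := hAbdd
  have hAtr : ∀ x ∈ U, ∀ t ∈ Ioc 0 T, (A x t).trace ≤ n * C := fun x hx t ht => by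
    have := Finset.sum_le_sum (s := Finset.univ) fun i (_ : i ∈ Finset.univ) =>
      (le_abs_self _).trans (hC x hx t ht i i)
    simpa [Matrix.trace] using this
  let Pos : EuclideanSpace ℝ (Fin n) → EuclideanSpace ℝ (Fin n) → Prop := fun x y =>
    ∀ t₁ t₂, 0 < t₁ → t₁ < t₂ → t₂ ≤ T → m < u x t₁ → m < u y t₂
  have hseg : ∀ x y, segment ℝ x y ⊆ U → Pos x y := fun x y hxy t₁ t₂ h1 h2 h3 =>
    pos_of_segment_subset hU hAsymm hc₀ hAell hAtr hu hsuper hm hxy h1 h2 h3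
  have hPos : ∀ x ∈ U, ∀ y ∈ U, Pos x y := fun x hx y hy => by
    -- The relation holds both ways inside a ball, and composes by spending half of the available
    -- time on each leg; connectedness then gives it for all pairs.
    refine hUc.induction₂' Pos (fun x hx => ?_) (fun x y z _ _ _ hxy hyz t₁ t₂ h1 h2 h3 h => ?_)
      hx hy
    · obtain ⟨ε, hε, hball⟩ := Metric.isOpen_iff.1 hU x hx
      filter_upwards [mem_nhdsWithin_of_mem_nhds (Metric.ball_mem_nhds x hε)] with y hy
      have hs := ((convex_ball x ε).segment_subset (Metric.mem_ball_self hε) hy).trans hball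
      exact ⟨hseg _ _ hs, hseg _ _ (by rwa [segment_symm])⟩
    · exact hyz ((t₁ + t₂) / 2) t₂ (by linarith) (by linarith) h3
        (hxy t₁ ((t₁ + t₂) / 2) h1 (by linarith) (by linarith) h)
  intro x hx t ht
  have htT : t ∈ Ioc 0 T := ⟨ht.1, ht.2.trans ht₀.2⟩
  by_contra hne
  have hlt : m < u x t := lt_of_le_of_ne (hm x hx t htT) (Ne.symm hne)
  have hev : ∀ᶠ s in 𝓝[Ioc 0 T] t, m < u x s :=
    (hu.diff_t x hx t htT).continuousWithinAt.eventually (lt_mem_nhds hlt)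
  obtain ⟨ε, hε, hball⟩ := Metric.mem_nhdsWithin_iff.1 hev
  -- A slightly earlier positive time with u still above m: propagation needs strictly increasing
  -- times, and t = t₀ is allowed.
  set s := max (t / 2) (t - ε / 2) with hs
  have hst : s < t := max_lt (by linarith [ht.1]) (by linarith)
  have hs0 : 0 < s := lt_max_of_lt_left (by linarith [ht.1])
  have hsε : t - ε / 2 ≤ s := le_max_right _ _
  have hms : m < u x s := hball ⟨by
    rw [Metric.mem_ball, Real.dist_eq, abs_lt]
    constructor <;> linarith, hs0, hst.le.trans htT.2⟩
  have := hPos x hx x₀ hx₀ s t₀ hs0 (hst.trans_le ht.2) ht₀.2 hms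
  linarith

theorem pderiv_neg (i : Fin n) (f : EuclideanSpace ℝ (Fin n) → ℝ) :
    (pderiv i fun y => -f y) = fun x => -pderiv i f x := by
  funext x
  simp [pderiv, lineDeriv]

theorem grad_neg (f : EuclideanSpace ℝ (Fin n) → ℝ) (x : EuclideanSpace ℝ (Fin n)) :
    grad (fun y => -f y) x = -grad f x := by
  ext i
  simp [grad, pderiv_neg]

theorem hess_neg (f : EuclideanSpace ℝ (Fin n) → ℝ) (x : EuclideanSpace ℝ (Fin n)) :
    hess (fun y => -f y) x = -hess f x := by
  ext i j
  simp [hess, pderiv_neg]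

theorem HasPderiv.neg {i : Fin n} {f : EuclideanSpace ℝ (Fin n) → ℝ}
    {x : EuclideanSpace ℝ (Fin n)} (h : HasPderiv i f x) : HasPderiv i (fun y => -f y) x :=
  DifferentiableAt.neg h

theorem IsC21.neg {U : Set (EuclideanSpace ℝ (Fin n))} {I : Set ℝ}
    {u : EuclideanSpace ℝ (Fin n) → ℝ → ℝ} (hu : IsC21 U I u) :
    IsC21 U I fun x t => -u x t where
  cont := hu.cont.neg
  diff_t x hx t ht := (hu.diff_t x hx t ht).neg
  cont_t := by
    simp only [derivWithin.fun_neg]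
    exact hu.cont_t.neg
  diff_x i x hx t ht := (hu.diff_x i x hx t ht).neg
  cont_x i := by
    simp only [pderiv_neg]
    exact (hu.cont_x i).neg
  diff_xx i j x hx t ht := by
    rw [pderiv_neg]
    exact (hu.diff_xx i j x hx t ht).neg
  cont_xx i j := by
    simp only [pderiv_neg]
    exact (hu.cont_xx i j).neg

theorem IsC21.continuousOn_grad {U : Set (EuclideanSpace ℝ (Fin n))} {I : Set ℝ}
    {u : EuclideanSpace ℝ (Fin n) → ℝ → ℝ} (hu : IsC21 U I u) :
    ContinuousOn (fun p : EuclideanSpace ℝ (Fin n) × ℝ => grad (fun y => u y p.2) p.1)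
      (U ×ˢ I) :=
  (PiLp.continuous_toLp 2 _).comp_continuousOn (continuousOn_pi.2 hu.cont_x)

/-- On compact sets the first order terms of `opL` are dominated by a multiple of `|∇u|`. -/
theorem exists_firstOrder_le {U : Set (EuclideanSpace ℝ (Fin n))} {I : Set ℝ}
    {B : EuclideanSpace ℝ (Fin n) → ℝ → EuclideanSpace ℝ (Fin n)}
    (hBbdd : ∃ C : ℝ, ∀ x ∈ U, ∀ t ∈ I, ‖B x t‖ ≤ C) {J : Set ℝ} (hJ : J.OrdConnected)
    (hJint : (interior J).Nonempty) {P : ℝ → ℝ} (hP : ContDiffOn ℝ 1 P J)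
    {u : EuclideanSpace ℝ (Fin n) → ℝ → ℝ} (hu : IsC21 U I u)
    (huJ : ∀ x ∈ U, ∀ t ∈ I, u x t ∈ J)
    (hubdd : ∃ C : ℝ, ∀ x ∈ U, ∀ t ∈ I, |u x t| ≤ C) (c : ℝ)
    {S : Set (EuclideanSpace ℝ (Fin n) × ℝ)} (hSU : S ⊆ U ×ˢ I) (hS : IsCompact S) :
    ∃ C : ℝ, ∀ p ∈ S, |u p.1 p.2 * inner ℝ (B p.1 p.2) (grad (fun y => u y p.2) p.1)| +
      derivWithin P J (u p.1 p.2) * (c * ‖grad (fun y => u y p.2) p.1‖ ^ 2) ≤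
        C * ‖grad (fun y => u y p.2) p.1‖ := by
  obtain ⟨b, hb⟩ := hBbdd
  obtain ⟨a, ha⟩ := hubdd
  have hPc : ContinuousOn (derivWithin P J) J :=
    hP.continuousOn_derivWithin (uniqueDiffOn_convex hJ.convex hJint) le_rfl
  have hPu : ContinuousOn
      (fun p : EuclideanSpace ℝ (Fin n) × ℝ => derivWithin P J (u p.1 p.2)) (U ×ˢ I) :=
    hPc.comp hu.cont fun p hp => huJ _ hp.1 _ hp.2
  -- One of the two factors |∇u| goes into a continuous coefficient, bounded on the compact set S;
  -- the other remains, so the quadratic term becomes linear in |∇u|.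
  have hcont : ContinuousOn (fun p : EuclideanSpace ℝ (Fin n) × ℝ =>
      derivWithin P J (u p.1 p.2) * (c * ‖grad (fun y => u y p.2) p.1‖)) S :=
    (hPu.mul (continuousOn_const.mul hu.continuousOn_grad.norm)).mono hSU
  obtain ⟨d, hd⟩ := hS.exists_bound_of_continuousOn hcont
  refine ⟨a * b + d, fun p hp => ?_⟩
  obtain ⟨hpU, hpI⟩ := hSU hp
  have h1 := (le_abs_self _).trans (hd p hp)
  set g := grad (fun y => u y p.2) p.1
  have ha' := ha _ hpU _ hpI
  have h2 : |u p.1 p.2 * inner ℝ (B p.1 p.2) g| ≤ a * (b * ‖g‖) := by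
    rw [abs_mul]
    refine mul_le_mul ha' ?_ (abs_nonneg _) ((abs_nonneg _).trans ha')
    exact (abs_real_inner_le_norm _ _).trans
      (mul_le_mul_of_nonneg_right (hb _ hpU _ hpI) (norm_nonneg _))
  have h3 := mul_le_mul_of_nonneg_right h1 (norm_nonneg g)
  nlinarith

end FluidPDE

theorem theorem3p2 {n : ℕ} (hn : 1 ≤ n)
    (U : Set (EuclideanSpace ℝ (Fin n))) (hUo : IsOpen U) (hUb : Bornology.IsBounded U)
    (hUc : IsConnected U) (T : ℝ) (hT : 0 < T)
    (A K : EuclideanSpace ℝ (Fin n) → ℝ → Matrix (Fin n) (Fin n) ℝ)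
    (B : EuclideanSpace ℝ (Fin n) → ℝ → EuclideanSpace ℝ (Fin n))
    (hAsymm : ∀ x ∈ U, ∀ t ∈ Set.Ioc 0 T, (A x t).IsSymm)
    (hAell : ∃ c₀ : ℝ, 0 < c₀ ∧ ∀ x ∈ U, ∀ t ∈ Set.Ioc 0 T,
      ∀ ξ : EuclideanSpace ℝ (Fin n), c₀ * ‖ξ‖ ^ 2 ≤ FluidPDE.quad (A x t) ξ)
    (hAbdd : ∃ C : ℝ, ∀ x ∈ U, ∀ t ∈ Set.Ioc 0 T, ∀ i j, |A x t i j| ≤ C)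
    (hBbdd : ∃ C : ℝ, ∀ x ∈ U, ∀ t ∈ Set.Ioc 0 T, ‖B x t‖ ≤ C)
    (J : Set ℝ) (hJ : J.OrdConnected) (hJint : (interior J).Nonempty)
    (P : ℝ → ℝ) (hP : ContDiffOn ℝ 1 P J) (hP' : ∀ s ∈ J, 0 ≤ derivWithin P J s)
    (u : EuclideanSpace ℝ (Fin n) → ℝ → ℝ)
    (hu : FluidPDE.IsC21 U (Set.Ioc 0 T) u)
    (huJ : ∀ x ∈ U, ∀ t ∈ Set.Ioc 0 T, u x t ∈ J)
    (hubdd : ∃ C : ℝ, ∀ x ∈ U, ∀ t ∈ Set.Ioc 0 T, |u x t| ≤ C) :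
    ((∃ c₁ : ℝ, 0 ≤ c₁ ∧ ∀ x ∈ U, ∀ t ∈ Set.Ioc 0 T,
        ∀ ξ : EuclideanSpace ℝ (Fin n), -c₁ * ‖ξ‖ ^ 2 ≤ FluidPDE.quad (K x t) ξ) →
      (∀ x ∈ U, ∀ t ∈ Set.Ioc 0 T, FluidPDE.opL A K B J P (Set.Ioc 0 T) u x t ≤ 0) →
      ∀ M : ℝ, IsLUB {r | ∃ x ∈ U, ∃ t ∈ Set.Ioc 0 T, u x t = r} M →
      ∀ x₀ ∈ U, ∀ t₀ ∈ Set.Ioc 0 T, u x₀ t₀ = M →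
      ∀ x ∈ U, ∀ t ∈ Set.Ioc 0 t₀, u x t = M) ∧
    ((∃ c₂ : ℝ, 0 ≤ c₂ ∧ ∀ x ∈ U, ∀ t ∈ Set.Ioc 0 T,
        ∀ ξ : EuclideanSpace ℝ (Fin n), FluidPDE.quad (K x t) ξ ≤ c₂ * ‖ξ‖ ^ 2) →
      (∀ x ∈ U, ∀ t ∈ Set.Ioc 0 T, 0 ≤ FluidPDE.opL A K B J P (Set.Ioc 0 T) u x t) →
      ∀ m : ℝ, IsGLB {r | ∃ x ∈ U, ∃ t ∈ Set.Ioc 0 T, u x t = r} m →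
      ∀ x₀ ∈ U, ∀ t₀ ∈ Set.Ioc 0 T, u x₀ t₀ = m →
      ∀ x ∈ U, ∀ t ∈ Set.Ioc 0 t₀, u x t = m) := by
  constructor
  · rintro ⟨c₁, -, hK⟩ hL M hM x₀ hx₀ t₀ ht₀ h₀ x hx t ht
    -- The minimum principle is applied to -u. The coefficients u B and P'(u) keep the original u,
    -- and |∇u| does not see the sign.
    refine neg_injective (FluidPDE.eq_of_isMin_of_supersolution hUo hUc.isPreconnected hAsymm
      hAell hAbdd hu.neg (fun S hSU hS => ?_) (m := -M)
      (fun x hx t ht => neg_le_neg (hM.1 ⟨x, hx, t, ht, rfl⟩)) hx₀ ht₀ (by rw [h₀]) x hx t ht)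
    obtain ⟨C, hC⟩ := FluidPDE.exists_firstOrder_le hBbdd hJ hJint hP hu huJ hubdd c₁ hSU hS
    refine ⟨C, fun p hp => ?_⟩
    obtain ⟨hpU, hpI⟩ := hSU hp
    have h1 := hL _ hpU _ hpI
    have h2 := hC p hp
    have h3 := mul_le_mul_of_nonneg_left (hK _ hpU _ hpI
      (FluidPDE.grad (fun y => u y p.2) p.1)) (hP' _ (huJ _ hpU _ hpI))
    have h4 := neg_abs_le (u p.1 p.2 * inner ℝ (B p.1 p.2)
      (FluidPDE.grad (fun y => u y p.2) p.1))
    rw [FluidPDE.opL] at h1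
    rw [derivWithin.fun_neg, FluidPDE.hess_neg, FluidPDE.grad_neg, norm_neg, Matrix.mul_neg,
      Matrix.trace_neg]
    linarith
  · rintro ⟨c₂, -, hK⟩ hL m hm x₀ hx₀ t₀ ht₀ h₀
    refine FluidPDE.eq_of_isMin_of_supersolution hUo hUc.isPreconnected hAsymm
      hAell hAbdd hu (fun S hSU hS => ?_)
      (fun x hx t ht => hm.1 ⟨x, hx, t, ht, rfl⟩) hx₀ ht₀ h₀
    obtain ⟨C, hC⟩ := FluidPDE.exists_firstOrder_le hBbdd hJ hJint hP hu huJ hubdd c₂ hSU hS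
    refine ⟨C, fun p hp => ?_⟩
    obtain ⟨hpU, hpI⟩ := hSU hp
    have h1 := hL _ hpU _ hpI
    have h2 := hC p hp
    have h3 := mul_le_mul_of_nonneg_left (hK _ hpU _ hpI
      (FluidPDE.grad (fun y => u y p.2) p.1)) (hP' _ (huJ _ hpU _ hpI))
    have h4 := le_abs_self (u p.1 p.2 * inner ℝ (B p.1 p.2)
      (FluidPDE.grad (fun y => u y p.2) p.1))
    rw [FluidPDE.opL] at h1
    linarith
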